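/- Call a linear order scattered if it contains no isomorphic copy of $\mathbb{Q}$. A retraction is a continuous map $r:X\to Y$ with a continuous right inverse. An inverse sequence $\langle X_\xi, r^\eta_\xi\rangle_{\xi\le\eta<\kappa}$ ($\kappa$ an ordinal) is continuous if for each limit ordinal $\delta<\kappa$ the space $X_\delta$ with the maps $r^\delta_\xi$, $\xi<\delta$, is the inverse limit of $\langle X_\xi, r^\eta_\xi\rangle_{\xi\le\eta<\delta}$. Let $\mathcal R$ be the smallest class of compact Hausdorff spaces that contains all compact metrizable spaces and is closed under limits of continuous inverse sequences all of whose bonding maps are retractions; let $\mathcal{RC}$ be the smallest class of compact Hausdorff spaces that contains all compact metrizable spaces and is closed both under such limits and under continuous Hausdorff images. Corollary. Let $K$ be a scattered linearly ordered set which is compact in its order topology. Let $L=K\cdot 2$ be $K\times\{0,1\}$ with the lexicographic order ($(x,i)<(y,j)$ iff $x<y$, or $x=y$ and $i<j$) and the order topology. Then $L$ is scattered, compact, and belongs to $\mathcal R$. The projection $(x,i)\mapsto x$ is an order-preserving continuous surjection of $L$ onto $K$, each of whose fibres has exactly two points. In particular $K\in\mathcal{RC}$. -/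

import Mathlib

open Set Topology

universe u

/-- A linear order is scattered if it contains no isomorphic copy of the rationals. -/
def IsScatteredOrder (K : Type u) [LinearOrder K] : Prop :=
  IsEmpty (ℚ ↪o K)

/-- A retraction (right-invertible map): a continuous map with a continuous right inverse. -/
def IsRetractionMap {X Y : Type u} [TopologicalSpace X] [TopologicalSpace Y] (f : X → Y) : Prop :=
  Continuous f ∧ ∃ g : Y → X, Continuous g ∧ ∀ y, f (g y) = y

/-- The set of threads in the product: the standard model of the inverse limit, which carries
the topology inherited from the product. -/
def inverseLimitSet {ι : Type u} [Preorder ι] {X : ι → Type u}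
    (p : ∀ ⦃i j : ι⦄, i ≤ j → X j → X i) : Set (∀ i, X i) :=
  {x | ∀ ⦃i j : ι⦄ (h : i ≤ j), p h (x j) = x i}

/-- The space `Y` with the projections `q i` is the inverse limit of the system `(X, p)`:
the map `y ↦ (q i y)_i` is a homeomorphism of `Y` onto the space of threads. -/
def IsInverseLimit {ι : Type u} [Preorder ι] {X : ι → Type u} [∀ i, TopologicalSpace (X i)]
    (p : ∀ ⦃i j : ι⦄, i ≤ j → X j → X i)
    {Y : Type u} [TopologicalSpace Y] (q : ∀ i, Y → X i) : Prop :=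
  IsEmbedding (fun (y : Y) (i : ι) => q i y) ∧
    range (fun (y : Y) (i : ι) => q i y) = inverseLimitSet p

/-- A continuous inverse sequence of retractions. The index set is a well-ordered set `ι`
(that is, an ordinal up to isomorphism); at each limit element `δ` the space `X δ` with the
projections `p : X δ → X ξ`, `ξ < δ`, is the inverse limit of the preceding part. -/
structure IsContinuousRetractiveSequence {ι : Type u} [LinearOrder ι] [WellFoundedLT ι]
    (X : ι → Type u) [∀ i, TopologicalSpace (X i)]
    (p : ∀ ⦃i j : ι⦄, i ≤ j → X j → X i) : Prop where
  inverseSystem : InverseSystem p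
  retraction : ∀ ⦃i j : ι⦄ (h : i ≤ j), IsRetractionMap (p h)
  continuous_at_limit : ∀ δ : ι, Order.IsSuccLimit δ →
    IsInverseLimit (X := fun ξ : Iio δ => X ξ)
      (fun ξ η (h : ξ ≤ η) => p (i := (ξ : ι)) (j := (η : ι)) h)
      (fun ξ : Iio δ => p (i := (ξ : ι)) (j := δ) (le_of_lt ξ.2))

/-- Class `R`: the smallest class of spaces that contains all metrizable compacta and is closed
under limits of continuous inverse sequences of retractions. -/
inductive ClassR : (X : Type u) → [TopologicalSpace X] → Prop
  | metric (X : Type u) [TopologicalSpace X] [CompactSpace X] [TopologicalSpace.MetrizableSpace X] :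
      ClassR X
  | limit {ι : Type u} [LinearOrder ι] [WellFoundedLT ι]
      (X : ι → Type u) [∀ i, TopologicalSpace (X i)]
      (p : ∀ ⦃i j : ι⦄, i ≤ j → X j → X i)
      (Y : Type u) [TopologicalSpace Y] (q : ∀ i, Y → X i)
      (hp : IsContinuousRetractiveSequence X p) (hq : IsInverseLimit p q)
      (hX : ∀ i, ClassR (X i)) : ClassR Y

/-- Class `RC`: the smallest class of spaces that contains all metrizable compacta and is closed
under limits of continuous inverse sequences of retractions and under (Hausdorff) continuous
images. -/
inductive ClassRC : (X : Type u) → [TopologicalSpace X] → Prop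
  | metric (X : Type u) [TopologicalSpace X] [CompactSpace X] [TopologicalSpace.MetrizableSpace X] :
      ClassRC X
  | limit {ι : Type u} [LinearOrder ι] [WellFoundedLT ι]
      (X : ι → Type u) [∀ i, TopologicalSpace (X i)]
      (p : ∀ ⦃i j : ι⦄, i ≤ j → X j → X i)
      (Y : Type u) [TopologicalSpace Y] (q : ∀ i, Y → X i)
      (hp : IsContinuousRetractiveSequence X p) (hq : IsInverseLimit p q)
      (hX : ∀ i, ClassRC (X i)) : ClassRC Y
  | image (X Y : Type u) [TopologicalSpace X] [TopologicalSpace Y] [T2Space Y] (f : X → Y)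
      (hf : Continuous f) (hsurj : Function.Surjective f) (hX : ClassRC X) : ClassRC Y

/-! Every point of `K ×ₗ Fin 2` has an immediate successor or predecessor. In a compact order `L`
with this property, call two points equivalent when every closed interval between them lies in `R`.
Cutting at a jump splits an interval into two clopen intervals, and `R` is closed under sums
(`ClassR.sum`), so the relation is transitive. An interval whose right end is approached from below
is the limit of shorter ones under the retractions `x ↦ min x w` (`ClassR.Icc_of_isLUB`). Hence each
class has a greatest and, dually, a least element. Two distinct classes cannot be adjacent, since a
jump would merge them. Several classes would therefore give a dense set of maxima and a copy of `ℚ`.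
So in a scattered `L` there is one class, and `L` is in `R`; `K` is an image of its double. -/

/-! ### Closure properties of `R`. -/

theorem isClosed_inverseLimitSet {ι : Type u} [Preorder ι] {X : ι → Type u}
    [∀ i, TopologicalSpace (X i)] [∀ i, T2Space (X i)] {p : ∀ ⦃i j : ι⦄, i ≤ j → X j → X i}
    (hp : ∀ ⦃i j : ι⦄ (h : i ≤ j), Continuous (p h)) : IsClosed (inverseLimitSet p) := by
  simp only [inverseLimitSet, ofPred_forall]
  exact isClosed_iInter fun i => isClosed_iInter fun j => isClosed_iInter fun h =>
    isClosed_eq ((hp h).comp (continuous_apply j)) (continuous_apply i)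

theorem ClassR.compactSpace_t2Space {X : Type u} [TopologicalSpace X] (h : ClassR X) :
    CompactSpace X ∧ T2Space X := by
  induction h with
  | metric X => exact ⟨inferInstance, inferInstance⟩
  | limit X p Y q hp hq hX ih =>
    have := fun i => (ih i).1
    have := fun i => (ih i).2
    refine ⟨?_, hq.1.t2Space⟩
    have hc : IsClosedEmbedding (fun y i => q i y) :=
      ⟨hq.1, hq.2 ▸ isClosed_inverseLimitSet fun i j h => (hp.retraction h).1⟩
    exact hc.compactSpace

theorem ClassR.classRC {X : Type u} [TopologicalSpace X] (h : ClassR X) : ClassRC X := by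
  induction h with
  | metric X => exact .metric X
  | limit X p Y q hp hq hX ih => exact .limit X p Y q hp hq ih

theorem IsInverseLimit.of_homeomorph {ι : Type u} [Preorder ι] {X : ι → Type u}
    [∀ i, TopologicalSpace (X i)] {p : ∀ ⦃i j : ι⦄, i ≤ j → X j → X i}
    {Y Z : Type u} [TopologicalSpace Y] [TopologicalSpace Z] {q : ∀ i, Y → X i}
    (h : IsInverseLimit p q) (e : Z ≃ₜ Y) : IsInverseLimit p (fun i z => q i (e z)) := by
  refine ⟨h.1.comp e.isEmbedding, ?_⟩
  rw [← h.2]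
  exact e.surjective.range_comp (fun y i => q i y)

theorem ClassR.of_homeomorph {X Y : Type u} [TopologicalSpace X] [TopologicalSpace Y]
    (h : ClassR X) (e : Y ≃ₜ X) : ClassR Y := by
  cases h with
  | metric X =>
    have := e.symm.compactSpace
    have := e.isEmbedding.metrizableSpace
    exact .metric Y
  | limit X p _ q hp hq hX => exact .limit X p Y _ hp (hq.of_homeomorph e) hX

/-- The sum of an inverse limit of compact spaces over a nonempty directed index with a fixed
compact space is an inverse limit. -/
theorem IsInverseLimit.sum {ι : Type u} [LinearOrder ι] [Nonempty ι] {X : ι → Type u}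
    [∀ i, TopologicalSpace (X i)] [∀ i, T2Space (X i)] {p : ∀ ⦃i j : ι⦄, i ≤ j → X j → X i}
    {Y Z : Type u} [TopologicalSpace Y] [CompactSpace Y] [TopologicalSpace Z] [CompactSpace Z]
    [T2Space Z] {q : ∀ i, Y → X i} (h : IsInverseLimit p q) :
    IsInverseLimit (X := fun i => X i ⊕ Z) (fun _ _ hij => Sum.map (p hij) id)
      (fun i => Sum.map (q i) (id : Z → Z)) := by
  have hq : ∀ i, Continuous (q i) := fun i => (continuous_apply i).comp h.1.continuous
  have hthread : ∀ y ⦃i j : ι⦄ (hij : i ≤ j), p hij (q j y) = q i y := fun y => by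
    have : (fun i => q i y) ∈ inverseLimitSet p := h.2 ▸ mem_range_self y
    exact this
  refine ⟨IsClosedEmbedding.isEmbedding (Continuous.isClosedEmbedding ?_ ?_), ?_⟩
  · exact continuous_pi fun i => (hq i).sumMap continuous_id
  · rintro (a | a) (b | b) hab
    · congr 1
      refine h.1.injective (funext fun i => ?_)
      simpa using congrFun hab i
    · simpa using congrFun hab (Classical.arbitrary ι)
    · simpa using congrFun hab (Classical.arbitrary ι)
    · simpa using congrFun hab (Classical.arbitrary ι)
  · apply subset_antisymm
    · rintro _ ⟨y | z, rfl⟩ i j hij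
      · simp [hthread]
      · simp
    · intro w hw
      let i₀ := Classical.arbitrary ι
      have key : ∀ i j (hij : i ≤ j), Sum.map (p hij) id (w j) = w i := fun i j hij => hw hij
      -- Bonding maps respect the summands, so a thread stays on one side.
      have hside : ∀ i, (w i).isLeft = (w i₀).isLeft := by
        intro i
        rcases le_total i i₀ with hi | hi
        · rw [← key _ _ hi]; simp
        · rw [← key _ _ hi]; simp
      cases h0 : w i₀ with
      | inl x₀ =>
        have : ∀ i, ∃ x, w i = Sum.inl x := fun i => by
          have := hside i
          rw [h0] at this
          exact Sum.isLeft_iff.1 this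
        choose x hx using this
        have hxt : x ∈ inverseLimitSet p := fun i j hij => by
          have := key i j hij
          rw [hx, hx] at this
          simpa using this
        rw [← h.2] at hxt
        obtain ⟨y, hy⟩ := hxt
        refine ⟨Sum.inl y, funext fun i => ?_⟩
        rw [hx, ← hy]
        rfl
      | inr z₀ =>
        refine ⟨Sum.inr z₀, funext fun i => ?_⟩
        have := hside i
        rw [h0] at this
        rcases le_total i i₀ with hi | hi
        · rw [← key _ _ hi, h0]; rfl
        · have h1 := key _ _ hi
          cases hwi : w i with
          | inl x => rw [hwi] at this; simp at this
          | inr z => rw [hwi, h0] at h1; simpa using h1.symm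

theorem IsRetractionMap.sumMap_id {X Y : Type u} (Z : Type u) [TopologicalSpace X]
    [TopologicalSpace Y] [TopologicalSpace Z] {f : X → Y} (hf : IsRetractionMap f) :
    IsRetractionMap (Sum.map f (id : Z → Z)) := by
  obtain ⟨hf, g, hg, hfg⟩ := hf
  refine ⟨hf.sumMap continuous_id, Sum.map g id, hg.sumMap continuous_id, ?_⟩
  rintro (y | z) <;> simp [hfg]

theorem IsInverseLimit.subsingleton {ι : Type u} [Preorder ι] [IsEmpty ι] {X : ι → Type u}
    [∀ i, TopologicalSpace (X i)] {p : ∀ ⦃i j : ι⦄, i ≤ j → X j → X i}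
    {Y : Type u} [TopologicalSpace Y] {q : ∀ i, Y → X i} (h : IsInverseLimit p q) :
    Subsingleton Y :=
  h.1.injective.subsingleton

theorem ClassR.of_finite (X : Type u) [TopologicalSpace X] [T2Space X] [Finite X] : ClassR X :=
  .metric X

theorem IsContinuousRetractiveSequence.sum {ι : Type u} [LinearOrder ι] [WellFoundedLT ι]
    {X : ι → Type u} [∀ i, TopologicalSpace (X i)] [∀ i, CompactSpace (X i)]
    [∀ i, T2Space (X i)] {p : ∀ ⦃i j : ι⦄, i ≤ j → X j → X i}
    (hp : IsContinuousRetractiveSequence X p) (Z : Type u) [TopologicalSpace Z] [CompactSpace Z]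
    [T2Space Z] : IsContinuousRetractiveSequence (fun i => X i ⊕ Z)
      (fun _ _ hij => Sum.map (p hij) id) where
  inverseSystem := by
    have := hp.inverseSystem
    refine ⟨?_, ?_⟩
    · rintro i (x | z) <;> simp [this.map_self]
    · rintro k j i hkj hji (x | z) <;> simp [this.map_map]
  retraction i j h := (hp.retraction h).sumMap_id Z
  continuous_at_limit δ hδ := by
    have : Nonempty (Iio δ) := by
      have := hδ.not_isMin
      rw [not_isMin_iff] at this
      exact ⟨⟨_, this.choose_spec⟩⟩
    exact (hp.continuous_at_limit δ hδ).sum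

/-- Induction on one summand with the other fixed, used twice: it reduces `X` to a metrizable space,
then, after a swap, `Y` as well. -/
theorem ClassR.sum {X Y : Type u} [TopologicalSpace X] [TopologicalSpace Y]
    (hX : ClassR X) (hY : ClassR Y) : ClassR (X ⊕ Y) := by
  have key : ∀ (Z : Type u) [TopologicalSpace Z] [CompactSpace Z] [T2Space Z]
      (_ : ∀ (M : Type u) [TopologicalSpace M] [CompactSpace M]
        [TopologicalSpace.MetrizableSpace M], ClassR (M ⊕ Z))
      {X : Type u} [TopologicalSpace X], ClassR X → ClassR (X ⊕ Z) := by
    intro Z _ _ _ hM X _ hX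
    induction hX with
    | metric X => exact hM X
    | @limit ι _ _ X _ p Y _ q hp hq hX ih =>
      have := fun i => (hX i).compactSpace_t2Space.1
      have := fun i => (hX i).compactSpace_t2Space.2
      obtain ⟨_, _⟩ := (ClassR.limit X p Y q hp hq hX).compactSpace_t2Space
      cases isEmpty_or_nonempty ι with
      -- The empty limit is a point, and adding `Z` termwise would lose `Z`; but a point is
      -- metrizable.
      | inl h =>
        have := hq.subsingleton
        exact hM Y
      | inr h => exact .limit _ _ _ _ (hp.sum Z) hq.sum ih
  obtain ⟨_, _⟩ := hY.compactSpace_t2Space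
  refine key Y (fun M _ _ _ => ?_) hX
  refine ClassR.of_homeomorph (key M (fun N _ _ _ => ?_) hY) (Homeomorph.sumComm M Y)
  let _ := TopologicalSpace.metrizableSpaceMetric M
  let _ := TopologicalSpace.metrizableSpaceMetric N
  have : TopologicalSpace.MetrizableSpace (N ⊕ M) :=
    let _ : MetricSpace (N ⊕ M) := Metric.metricSpaceSum
    inferInstance
  exact .metric _

/-! ### Compactness and suprema; the doubled order. -/

theorem exists_isLUB_of_compactSpace {K : Type*} [LinearOrder K] [TopologicalSpace K]
    [OrderTopology K] [CompactSpace K] (S : Set K) (hS : S.Nonempty) : ∃ x, IsLUB S x := by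
  obtain ⟨x, -, hx⟩ := isClosed_closure.isCompact.exists_isLUB (s := closure S) hS.closure
  exact ⟨x, fun y hy => hx.1 (subset_closure hy),
    fun b hb => hx.2 (closure_minimal (t := Iic b) hb isClosed_Iic)⟩

theorem compactSpace_of_forall_exists_isLUB {L : Type*} [LinearOrder L] [TopologicalSpace L]
    [OrderTopology L] (h : ∀ S : Set L, ∃ x, IsLUB S x) : CompactSpace L := by
  choose f hf using h
  let _ : SupSet L := ⟨f⟩
  let c : CompleteLattice L :=
    { completeLatticeOfSup L hf with
      toLattice := inferInstance }
  let _ : ConditionallyCompleteLinearOrder L :=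
    { ‹LinearOrder L›, c with
      isLUB_csSup := fun s _ _ => hf s
      isGLB_csInf := fun s _ _ => c.isGLB_sInf s
      csSup_of_not_bddAbove := fun s hs => absurd ⟨_, (hf s).1⟩ hs
      csInf_of_not_bddBelow := fun s hs => absurd ⟨_, (c.isGLB_sInf s).1⟩ hs }
  refine ⟨?_⟩
  have : (univ : Set L) = Icc (f ∅) (f univ) :=
    (eq_univ_of_forall fun x => mem_Icc.2 ⟨(hf ∅).2 (by simp), (hf univ).1 (mem_univ x)⟩).symm
  rw [this]
  exact isCompact_Icc

section Double
variable {K : Type u} [LinearOrder K]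

theorem lex_fin_two_cases {K : Type u} (x : K ×ₗ Fin 2) :
    x = toLex ((ofLex x).1, 0) ∨ x = toLex ((ofLex x).1, 1) := by
  rcases x with ⟨a, i⟩
  fin_cases i
  · exact Or.inl rfl
  · exact Or.inr rfl

theorem lex_fin_two_covBy (x : K) : (toLex (x, 0) : K ×ₗ Fin 2) ⋖ toLex (x, 1) := by
  rw [Prod.Lex.toLex_covBy_toLex_iff]
  exact Or.inl ⟨rfl, by decide, fun c _ _ => by omega⟩

theorem monotone_fst_lex : Monotone (fun x : K ×ₗ Fin 2 => (ofLex x).1) :=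
  Prod.Lex.monotone_fst_ofLex

theorem continuous_fst_lex_fin_two [TopologicalSpace K] [OrderTopology K]
    [TopologicalSpace (K ×ₗ Fin 2)] [OrderTopology (K ×ₗ Fin 2)] :
    Continuous (fun x : K ×ₗ Fin 2 => (ofLex x).1) := by
  rw [OrderTopology.topology_eq_generate_intervals (α := K), continuous_generateFrom_iff]
  rintro _ ⟨b, rfl | rfl⟩
  · convert isOpen_Ioi (a := (toLex (b, 1) : K ×ₗ Fin 2)) using 1
    ext ⟨a, i⟩
    change b < a ↔ (toLex (b, 1) : K ×ₗ Fin 2) < toLex (a, i)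
    rw [Prod.Lex.toLex_lt_toLex]
    have : ¬ (1 : Fin 2) < i := by omega
    simp [this]
  · convert isOpen_Iio (a := (toLex (b, 0) : K ×ₗ Fin 2)) using 1
    ext ⟨a, i⟩
    change a < b ↔ (toLex (a, i) : K ×ₗ Fin 2) < toLex (b, 0)
    rw [Prod.Lex.toLex_lt_toLex]
    simp

theorem ncard_fiber_fst_lex_fin_two (y : K) :
    ((fun x : K ×ₗ Fin 2 => (ofLex x).1) ⁻¹' {y}).ncard = 2 := by
  have : (fun x : K ×ₗ Fin 2 => (ofLex x).1) ⁻¹' {y} = {toLex (y, 0), toLex (y, 1)} := by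
    ext x
    constructor
    · rintro rfl
      exact lex_fin_two_cases x
    · rintro (rfl | rfl) <;> rfl
  rw [this, ncard_pair (lex_fin_two_covBy y).lt.ne]

theorem exists_isLUB_lex_fin_two (hK : ∀ S : Set K, S.Nonempty → ∃ x, IsLUB S x)
    (S : Set (K ×ₗ Fin 2)) (hS : S.Nonempty) : ∃ x, IsLUB S x := by
  obtain ⟨s, hs⟩ := hK _ (hS.image fun x : K ×ₗ Fin 2 => (ofLex x).1)
  have hle : ∀ x ∈ S, (ofLex x).1 ≤ s := fun x hx => hs.1 (mem_image_of_mem _ hx)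
  -- Over `s` the set `S` can only contain `(s, 0)` when it misses `(s, 1)`.
  by_cases h1 : toLex (s, (1 : Fin 2)) ∈ S
  · refine ⟨toLex (s, 1), fun x hx => ?_, fun b hb => hb h1⟩
    rw [Prod.Lex.le_iff]
    rcases (hle x hx).lt_or_eq with h | h
    · exact Or.inl h
    · exact Or.inr ⟨h, by change _ ≤ (1 : Fin 2); omega⟩
  · refine ⟨toLex (s, 0), fun x hx => ?_, fun b hb => ?_⟩
    · rw [Prod.Lex.le_iff]
      rcases (hle x hx).lt_or_eq with h | h
      · exact Or.inl h
      · refine Or.inr ⟨h, ?_⟩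
        rcases lex_fin_two_cases x with hx' | hx'
        · rw [hx']; simp
        · exact absurd (by rwa [hx', h] at hx) h1
    · have : s ≤ (ofLex b).1 := hs.2 (by
        rintro _ ⟨x, hx, rfl⟩
        exact monotone_fst_lex (hb hx))
      rw [Prod.Lex.le_iff]
      rcases this.lt_or_eq with h | h
      · exact Or.inl h
      · exact Or.inr ⟨h, by change (0 : Fin 2) ≤ _; omega⟩

theorem compactSpace_lex_fin_two [TopologicalSpace K] [OrderTopology K] [CompactSpace K]
    [TopologicalSpace (K ×ₗ Fin 2)] [OrderTopology (K ×ₗ Fin 2)] :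
    CompactSpace (K ×ₗ Fin 2) := by
  cases isEmpty_or_nonempty K with
  | inl h =>
    have : IsEmpty (K ×ₗ Fin 2) := ⟨fun x => h.elim (ofLex x).1⟩
    infer_instance
  | inr h =>
    obtain ⟨b, -, hb⟩ := isCompact_univ.exists_isLeast (univ_nonempty (α := K))
    refine compactSpace_of_forall_exists_isLUB fun S => ?_
    rcases S.eq_empty_or_nonempty with rfl | hS
    · refine ⟨toLex (b, 0), by simp, fun x _ => ?_⟩
      rw [Prod.Lex.le_iff]
      rcases (hb (mem_univ (ofLex x).1)).lt_or_eq with h | h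
      · exact Or.inl h
      · exact Or.inr ⟨h, by change (0 : Fin 2) ≤ _; omega⟩
    · exact exists_isLUB_lex_fin_two exists_isLUB_of_compactSpace S hS

/-- A copy of `ℚ` contains a copy of `ℚ ×ₗ Fin 2`. For `q < r` the images of `(q, 0) < (q, 1) < (r,
0)` are three points, too many for one fibre, so the first coordinate strictly increases along the
points `(q, 0)`. -/
theorem IsScatteredOrder.lex_fin_two (hK : IsScatteredOrder K) :
    IsScatteredOrder (K ×ₗ Fin 2) := by
  refine ⟨fun f => ?_⟩
  have : Countable (ℚ ×ₗ Fin 2) := inferInstanceAs (Countable (ℚ × Fin 2))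
  obtain ⟨e⟩ := Order.embedding_from_countable_to_dense (ℚ ×ₗ Fin 2) ℚ
  refine hK.false (OrderEmbedding.ofStrictMono
    (fun q => (ofLex (f (e (toLex (q, 0))))).1) fun q r hqr => ?_)
  have h1 : f (e (toLex (q, 0))) < f (e (toLex (q, 1))) := by
    simpa using (lex_fin_two_covBy q).lt
  have h2 : f (e (toLex (q, 1))) < f (e (toLex (r, 0))) := by
    simp [Prod.Lex.toLex_lt_toLex, hqr]
  rcases (monotone_fst_lex (h1.trans h2).le).lt_or_eq with h | h
  · exact h
  · exfalso
    rw [Prod.Lex.lt_iff] at h1 h2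
    have h3 := monotone_fst_lex (Prod.Lex.lt_iff.2 h1).le
    have h4 := monotone_fst_lex (Prod.Lex.lt_iff.2 h2).le
    simp only at h h3 h4
    rcases h1 with h1 | h1
    · exact absurd (h1.trans_le h4) (h ▸ lt_irrefl _)
    rcases h2 with h2 | h2
    · exact absurd (h3.trans_lt h2) (h ▸ lt_irrefl _)
    have := h1.2
    have := h2.2
    omega

end Double

/-! ### Intervals as inverse limits and as sums. -/

theorem isInverseLimit_Icc_min {L : Type u} [LinearOrder L] [TopologicalSpace L]
    [OrderTopology L] [CompactSpace L] {ι : Type u} [LinearOrder ι] [Nonempty ι] {v : ι → L}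
    (hv : Monotone v) {a t : L} (hav : ∀ i, a ≤ v i) (ht : IsLUB (range v) t) :
    IsInverseLimit (X := fun i => Icc a (v i))
      (fun i _ _ x => ⟨min x (v i), le_min x.2.1 (hav i), min_le_right _ _⟩)
      (fun i (x : Icc a t) => ⟨min x (v i), le_min x.2.1 (hav i), min_le_right _ _⟩) := by
  have : CompactSpace (Icc a t) := isCompact_iff_compactSpace.1 isClosed_Icc.isCompact
  refine ⟨IsClosedEmbedding.isEmbedding (Continuous.isClosedEmbedding ?_ ?_), ?_⟩
  · fun_prop
  · have key : ∀ x y : Icc a t, x < y → ∃ i, min (x : L) (v i) ≠ min (y : L) (v i) := by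
      intro x y hxy
      obtain ⟨_, ⟨i, rfl⟩, hi⟩ := (lt_isLUB_iff ht).1 (lt_of_lt_of_le hxy y.2.2)
      refine ⟨i, ne_of_lt ?_⟩
      rw [min_eq_left hi.le]
      exact lt_min hxy hi
    intro x y hxy
    have hxy' : ∀ i, min (x : L) (v i) = min (y : L) (v i) := fun i =>
      congrArg Subtype.val (congrFun hxy i)
    by_contra hne
    rcases lt_or_gt_of_ne hne with h | h
    · obtain ⟨i, hi⟩ := key x y h
      exact hi (hxy' i)
    · obtain ⟨i, hi⟩ := key y x h
      exact hi (hxy' i).symm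
  · apply subset_antisymm
    · rintro _ ⟨x, rfl⟩ i j hij
      refine Subtype.ext ?_
      simp [min_assoc, hv hij]
    · intro z hz
      have hz' : ∀ i j, i ≤ j → min (z j : L) (v i) = z i := fun i j hij =>
        congrArg Subtype.val (hz hij)
      obtain ⟨y, hy⟩ := exists_isLUB_of_compactSpace (range fun i => (z i : L)) (range_nonempty _)
      have hzy : ∀ i, (z i : L) ≤ y := fun i => hy.1 (mem_range_self i)
      have hay : a ≤ y := (z (Classical.arbitrary ι)).2.1.trans (hzy _)
      have hyt : y ≤ t := hy.2 (by
        rintro _ ⟨i, rfl⟩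
        exact (z i).2.2.trans (ht.1 (mem_range_self i)))
      refine ⟨⟨y, hay, hyt⟩, funext fun i => Subtype.ext ?_⟩
      change min y (v i) = z i
      -- A thread with `z i < v i` is constant from `i` on, so its supremum is `z i`.
      rcases (z i).2.2.lt_or_eq with h | h
      · have : y = z i := le_antisymm (hy.2 (by
          rintro _ ⟨j, rfl⟩
          rcases le_total i j with hij | hij
          · have h1 := hz' i j hij
            rcases min_choice (z j : L) (v i) with h2 | h2
            · exact (h2.symm.trans h1).le
            · exact absurd (h2.symm.trans h1) h.ne'
          · change (z j : L) ≤ z i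
            rw [← hz' j i hij]
            exact min_le_left _ _)) (hzy i)
        rw [this, min_eq_left h.le]
      · rw [h, min_eq_right (h ▸ hzy i)]

/-- Cofinal sets of an initial segment may be taken well-ordered and closed under suprema. -/
theorem exists_wellFoundedLT_cofinal {L : Type*} [LinearOrder L] {a s : L}
    (hs : IsLUB (Ico a s) s) :
    ∃ W : Set L, W ⊆ Ico a s ∧ WellFoundedLT W ∧ IsLUB W s ∧
      ∀ T ⊆ W, T.Nonempty → ∀ t, IsLUB T t → t < s → t ∈ W := by
  let r : Ico a s → Ico a s → Prop := WellOrderingRel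
  have hr : IsWellOrder (Ico a s) r := WellOrderingRel.isWellOrder
  -- The record points of the well-ordering `r`; on them `<` and `r` agree.
  let W₀ : Set (Ico a s) := {x | ∀ y, r y x → y < x}
  have hcof : ∀ z : Ico a s, ∃ x ∈ W₀, z ≤ x := by
    intro z
    have hne : {x | z ≤ x}.Nonempty := ⟨z, le_rfl⟩
    refine ⟨hr.wf.min _ hne, fun y hy => ?_, hr.wf.min_mem _ hne⟩
    have h1 : ¬ z ≤ y := fun h => hr.wf.not_lt_min _ h hy
    exact (not_le.1 h1).trans_le (hr.wf.min_mem _ hne)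
  have hlt : ∀ x ∈ W₀, ∀ y ∈ W₀, x < y → r x y := by
    intro x hx y hy hxy
    rcases trichotomous_of r x y with h | h | h
    · exact h
    · exact absurd h hxy.ne
    · exact absurd (hx y h) hxy.not_gt
  let V : Set L := Subtype.val '' W₀
  have hVcof : ∀ z, a ≤ z → z < s → ∃ x ∈ W₀, z < x.1 := by
    intro z haz hzs
    obtain ⟨c, hc, hzc⟩ := (lt_isLUB_iff hs).1 hzs
    obtain ⟨x, hx, hcx⟩ := hcof ⟨c, hc⟩
    exact ⟨x, hx, hzc.trans_le hcx⟩
  -- The closure of `V` under suprema below `s`.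
  let W : Set L := {w | w ∈ Ico a s ∧ IsLUB (V ∩ Iic w) w}
  have hVW : V ⊆ W := by
    rintro _ ⟨x, hx, rfl⟩
    exact ⟨x.2, fun y hy => hy.2, fun b hb => hb ⟨mem_image_of_mem _ hx, le_rfl⟩⟩
  refine ⟨W, fun w hw => hw.1, ?_, ⟨fun w hw => hw.1.2.le, fun b hb => ?_⟩, ?_⟩
  · choose n hn hn' using fun w : W => hVcof w w.2.1.1 w.2.1.2
    let A : W → Set (Ico a s) := fun w => {x | x ∈ W₀ ∧ w.1 < x.1}
    have hA : ∀ w, (A w).Nonempty := fun w => ⟨n w, hn w, hn' w⟩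
    -- The next record after `w`. It is strictly increasing in `w`, because some record lies in `(w,
    -- w']` whenever `w < w'`.
    let m : W → Ico a s := fun w => hr.wf.min (A w) (hA w)
    have hm : ∀ w, m w ∈ A w := fun w => hr.wf.min_mem (A w) (hA w)
    have hmin : ∀ w, ∀ x ∈ A w, m w ≤ x := fun w x hx => by
      by_contra! h
      exact hr.wf.not_lt_min (A w) hx (hlt _ hx.1 _ (hm w).1 h)
    refine ⟨Subrelation.wf (r := InvImage r m) ?_ (InvImage.wf m hr.wf)⟩
    intro w w' hww'
    refine hlt _ (hm w).1 _ (hm w').1 ?_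
    obtain ⟨_, ⟨⟨x, hx, rfl⟩, hxw'⟩, hwx⟩ := (lt_isLUB_iff w'.2.2).1 hww'
    have hxm : (x : L) < m w' := lt_of_le_of_lt hxw' (hm w').2
    exact (hmin w x ⟨hx, hwx⟩).trans_lt hxm
  · refine hs.2 fun z hz => ?_
    obtain ⟨x, hx, hzx⟩ := hcof ⟨z, hz⟩
    exact le_trans hzx (hb (hVW (mem_image_of_mem _ hx)))
  · rintro T hTW ⟨w, hw⟩ t ht hts
    refine ⟨⟨(hTW hw).1.1.trans (ht.1 hw), hts⟩, fun y hy => hy.2, fun b hb => ht.2 ?_⟩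
    intro w' hw'
    exact (hTW hw').2.2 fun y hy => hb ⟨hy.1, hy.2.trans (ht.1 hw')⟩

theorem ClassR.Icc_of_isLUB {L : Type u} [LinearOrder L] [TopologicalSpace L]
    [OrderTopology L] [CompactSpace L] {a s : L} (hs : IsLUB (Ico a s) s) (has : a < s)
    (h : ∀ d ∈ Ico a s, ClassR (Icc a d)) : ClassR (Icc a s) := by
  obtain ⟨W, hWs, hwf, hWlub, hWcl⟩ := exists_wellFoundedLT_cofinal hs
  have hne : Nonempty W := by
    by_contra hempty
    have : W = ∅ := not_nonempty_iff_eq_empty'.1 hempty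
    rw [this] at hWlub
    exact (hWlub.2 (by simp : a ∈ upperBounds ∅)).not_gt has
  have haW : ∀ w : W, a ≤ w := fun w => (hWs w.2).1
  refine ClassR.limit (ι := W) _ _ _ _ ?_ (isInverseLimit_Icc_min (v := Subtype.val)
    (Subtype.mono_coe _) haW (by rwa [Subtype.range_coe])) fun w => h w (hWs w.2)
  refine ⟨⟨fun i x => Subtype.ext ?_, fun k j i hkj hji x => Subtype.ext ?_⟩,
    fun i j hij => ⟨by fun_prop, fun x => ⟨x, x.2.1, x.2.2.trans hij⟩, by fun_prop,
      fun y => Subtype.ext ?_⟩, fun δ hδ => ?_⟩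
  · exact min_eq_left x.2.2
  · have : (k : L) ≤ j := hkj
    simp [min_assoc, this]
  · exact min_eq_left y.2.2
  · have hne' : Nonempty (Iio δ) := by
      obtain ⟨b, hb⟩ := not_isMin_iff.1 hδ.not_isMin
      exact ⟨⟨b, hb⟩⟩
    refine isInverseLimit_Icc_min (ι := Iio δ) (v := fun ξ => ((ξ : W) : L))
      (fun _ _ h => h) (fun ξ => haW ξ) ?_
    obtain ⟨t, ht⟩ := exists_isLUB_of_compactSpace
      (range fun ξ : Iio δ => ((ξ : W) : L)) (range_nonempty _)
    have htδ : t ≤ δ := ht.2 (by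
      rintro _ ⟨ξ, rfl⟩
      exact ξ.2.le)
    -- A supremum `t < δ` would belong to `W` and immediately precede `δ` there, which a limit
    -- element forbids.
    rcases htδ.lt_or_eq with hlt | heq
    · exfalso
      have htW : t ∈ W := hWcl _ (by rintro _ ⟨ξ, rfl⟩; exact ξ.1.2) (range_nonempty _) t ht
        (hlt.trans (hWs δ.2).2)
      refine hδ.2 ⟨t, htW⟩ ⟨hlt, fun c hc hcδ => ?_⟩
      exact (ht.1 (mem_range_self (⟨c, hcδ⟩ : Iio δ))).not_gt hc
    · exact heq ▸ ht

theorem ClassR.Icc_of_covBy {L : Type u} [LinearOrder L] [TopologicalSpace L]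
    [OrderTopology L] {u v y y' : L} (huy : u ≤ y) (hy : y ⋖ y') (hyv : y' ≤ v)
    (h₁ : ClassR (Icc u y)) (h₂ : ClassR (Icc y' v)) : ClassR (Icc u v) := by
  obtain ⟨_, _⟩ := h₁.compactSpace_t2Space
  obtain ⟨_, _⟩ := h₂.compactSpace_t2Space
  let f : Icc u y ⊕ Icc y' v → Icc u v :=
    Sum.elim (fun x => ⟨x, x.2.1, x.2.2.trans (hy.le.trans hyv)⟩)
      (fun x => ⟨x, huy.trans (hy.le.trans x.2.1), x.2.2⟩)
  have hf : Continuous f := Continuous.sumElim (by fun_prop) (by fun_prop)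
  have hlt : ∀ (a : Icc u y) (b : Icc y' v), (a : L) < b := fun a b =>
    a.2.2.trans_lt (hy.lt.trans_le b.2.1)
  have hbij : Function.Bijective f := by
    constructor
    · rintro (a | a) (b | b) hab <;> have hab' := congrArg Subtype.val hab
      · exact congrArg _ (Subtype.ext hab')
      · exact absurd hab' (hlt a b).ne
      · exact absurd hab' (hlt b a).ne'
      · exact congrArg _ (Subtype.ext hab')
    · rintro ⟨x, hux, hxv⟩
      rcases le_or_gt x y with h | h
      · exact ⟨Sum.inl ⟨x, hux, h⟩, rfl⟩
      · exact ⟨Sum.inr ⟨x, hy.ge_of_gt h, hxv⟩, rfl⟩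
  exact (h₁.sum h₂).of_homeomorph
    ((isHomeomorph_iff_continuous_bijective.2 ⟨hf, hbij⟩).homeomorph f).symm

/-! ### The equivalence relation and its classes. -/

/-- All closed subintervals of `[x, y]` belong to the class `R`. -/
def HereditarilyClassR {L : Type u} [LinearOrder L] [TopologicalSpace L] (x y : L) : Prop :=
  ∀ u v, x ≤ u → u ≤ v → v ≤ y → ClassR (Icc u v)

section
variable {L : Type u} [LinearOrder L] [TopologicalSpace L]

theorem HereditarilyClassR.mono {x y x' y' : L} (h : HereditarilyClassR x y) (hx : x ≤ x')
    (hy : y' ≤ y) : HereditarilyClassR x' y' := fun u v hu huv hv =>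
  h u v (hx.trans hu) huv (hv.trans hy)

theorem homeomorph_Icc_toDual (u v : L) :
    Nonempty (Icc (OrderDual.toDual v) (OrderDual.toDual u) ≃ₜ Icc u v) := by
  refine ⟨⟨⟨fun x => ⟨OrderDual.ofDual x.1, x.2.2, x.2.1⟩,
    fun x => ⟨OrderDual.toDual x.1, x.2.2, x.2.1⟩, fun _ => rfl, fun _ => rfl⟩, ?_, ?_⟩⟩
  · exact Continuous.subtype_mk (continuous_ofDual.comp continuous_subtype_val) _
  · exact Continuous.subtype_mk (continuous_toDual.comp continuous_subtype_val) _

theorem classR_Icc_toDual {u v : L} :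
    ClassR (Icc (OrderDual.toDual v) (OrderDual.toDual u)) ↔ ClassR (Icc u v) := by
  obtain ⟨e⟩ := homeomorph_Icc_toDual u v
  exact ⟨fun h => h.of_homeomorph e.symm, fun h => h.of_homeomorph e⟩

theorem hereditarilyClassR_toDual {x y : L} :
    HereditarilyClassR (OrderDual.toDual y) (OrderDual.toDual x) ↔ HereditarilyClassR x y :=
  ⟨fun h u v hu huv hv => classR_Icc_toDual.1
      (h (OrderDual.toDual v) (OrderDual.toDual u) hv huv hu),
    fun h u v hu huv hv => (classR_Icc_toDual (L := L) (u := OrderDual.ofDual v)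
      (v := OrderDual.ofDual u)).2
      (h (OrderDual.ofDual v) (OrderDual.ofDual u) hv huv hu)⟩

variable [OrderTopology L]

theorem HereditarilyClassR.refl (x : L) : HereditarilyClassR x x := by
  intro u v hu huv hv
  have : Subsingleton (Icc u v) := ⟨fun a b => Subtype.ext (le_antisymm
    (a.2.2.trans (hv.trans (hu.trans b.2.1))) (b.2.2.trans (hv.trans (hu.trans a.2.1))))⟩
  exact ClassR.of_finite _

theorem HereditarilyClassR.trans (hL : ∀ v : L, (∃ v', v ⋖ v') ∨ ∃ v', v' ⋖ v) {x y z : L}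
    (h₁ : HereditarilyClassR x y) (h₂ : HereditarilyClassR y z) : HereditarilyClassR x z := by
  intro u v hu huv hv
  rcases le_or_gt v y with hvy | hvy
  · exact h₁ u v hu huv hvy
  rcases le_or_gt y u with hyu | hyu
  · exact h₂ u v hyu huv hv
  rcases hL y with ⟨y', hy⟩ | ⟨y', hy⟩
  · have := hy.ge_of_gt hvy
    exact ClassR.Icc_of_covBy hyu.le hy this (h₁ _ _ hu hyu.le le_rfl) (h₂ _ _ hy.le this hv)
  · have := hy.le_of_lt hyu
    exact ClassR.Icc_of_covBy this hy hvy.le (h₁ _ _ hu this hy.le) (h₂ _ _ le_rfl hvy.le hv)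

theorem HereditarilyClassR.of_covBy {x y : L} (h : x ⋖ y) : HereditarilyClassR x y := by
  intro u v hu huv hv
  have : Finite (Icc u v) := ((Set.finite_singleton y).insert x).subset fun z hz => by
    rcases (hu.trans hz.1).eq_or_lt with hxz | hxz
    · exact Or.inl hxz.symm
    · exact Or.inr (le_antisymm (hz.2.trans hv) (h.ge_of_gt hxz))
  exact ClassR.of_finite _

variable [CompactSpace L]

/-- The equivalence class of `x` has a greatest element. -/
theorem HereditarilyClassR.exists_max (hL : ∀ v : L, (∃ v', v ⋖ v') ∨ ∃ v', v' ⋖ v) (x : L) :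
    ∃ s, x ≤ s ∧ HereditarilyClassR x s ∧ ∀ y, s < y → ¬ HereditarilyClassR s y := by
  obtain ⟨s, hs⟩ := exists_isLUB_of_compactSpace {y | x ≤ y ∧ HereditarilyClassR x y}
    ⟨x, le_rfl, .refl x⟩
  have hxs : x ≤ s := hs.1 ⟨le_rfl, .refl x⟩
  have hlt : ∀ d, d < s → HereditarilyClassR x d := fun d hd => by
    obtain ⟨c, hc, hdc⟩ := (lt_isLUB_iff hs).1 hd
    exact hc.2.mono le_rfl hdc.le
  have hgood : HereditarilyClassR x s := by
    -- Either `s` is reached by a single jump, or it is a limit from below.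
    by_cases hp : ∃ p, p ⋖ s
    · obtain ⟨p, hp⟩ := hp
      exact (hlt p hp.lt).trans hL (.of_covBy hp)
    intro u v hu huv hv
    rcases hv.lt_or_eq with hv | rfl
    · exact hlt v hv u v hu huv le_rfl
    rcases huv.lt_or_eq with huv | rfl
    · refine ClassR.Icc_of_isLUB ⟨fun y hy => hy.2.le, fun b hb => ?_⟩ huv
        fun d hd => hlt d hd.2 u d hu hd.1 le_rfl
      by_contra! hbv
      exact hp ⟨b, hbv, fun c hbc hcv =>
        (hb ⟨(hb ⟨le_rfl, huv⟩).trans hbc.le, hcv⟩).not_gt hbc⟩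
    · exact HereditarilyClassR.refl _ _ _ le_rfl le_rfl le_rfl
  exact ⟨s, hxs, hgood, fun y hy h => (hs.1 ⟨hxs.trans hy.le, hgood.trans hL h⟩).not_gt hy⟩

/-- The equivalence class of `x` has a least element. -/
theorem HereditarilyClassR.exists_min (hL : ∀ v : L, (∃ v', v ⋖ v') ∨ ∃ v', v' ⋖ v) (x : L) :
    ∃ s, s ≤ x ∧ HereditarilyClassR s x ∧ ∀ y, y < s → ¬ HereditarilyClassR y s := by
  have : CompactSpace Lᵒᵈ := ‹CompactSpace L›
  obtain ⟨s, h1, h2, h3⟩ := HereditarilyClassR.exists_max (L := Lᵒᵈ) (fun v => by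
    rcases hL (OrderDual.ofDual v) with ⟨v', hv⟩ | ⟨v', hv⟩
    · exact Or.inr ⟨OrderDual.toDual v', hv.toDual⟩
    · exact Or.inl ⟨OrderDual.toDual v', hv.toDual⟩) (OrderDual.toDual x)
  exact ⟨OrderDual.ofDual s, h1, (hereditarilyClassR_toDual (L := L) (x := OrderDual.ofDual s)).1 h2, fun y hy h =>
    h3 (OrderDual.toDual y) hy ((hereditarilyClassR_toDual (L := L) (y := OrderDual.ofDual s)).2 h)⟩

theorem IsScatteredOrder.hereditarilyClassR (hsc : IsScatteredOrder L)
    (hL : ∀ v : L, (∃ v', v ⋖ v') ∨ ∃ v', v' ⋖ v) (a b : L) :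
    HereditarilyClassR a b := by
  by_contra hnot
  -- The greatest elements of the classes.
  let T : Set L := {x | ∀ y, x < y → ¬ HereditarilyClassR x y}
  have hdense : DenselyOrdered T := by
    refine ⟨fun x y hxy => ?_⟩
    obtain ⟨m, hmy, hm, hm'⟩ := HereditarilyClassR.exists_min hL (y : L)
    have hxm : (x : L) < m := by
      by_contra! h
      exact x.2 y hxy (hm.mono h le_rfl)
    -- A jump from `x` to `m`, the least element of the class of `y`, would contradict the
    -- maximality of `x`. The class of a point in between stays below `m`, and its maximum lies in
    -- `T`.
    obtain ⟨z, hxz, hzm⟩ : ∃ z, (x : L) < z ∧ z < m := by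
      by_contra! h
      exact x.2 m hxm (.of_covBy ⟨hxm, fun c hc => (h c hc).not_gt⟩)
    obtain ⟨w, hzw, hw, hw'⟩ := HereditarilyClassR.exists_max hL z
    have hwm : w < m := by
      by_contra! h
      exact hm' z hzm (hw.mono le_rfl h)
    exact ⟨⟨w, hw'⟩, hxz.trans_le hzw, hwm.trans_le hmy⟩
  have hnt : Nontrivial T := by
    obtain ⟨s, has, hs, hs'⟩ := HereditarilyClassR.exists_max hL a
    obtain ⟨t, hbt, ht, ht'⟩ := HereditarilyClassR.exists_max hL b
    refine ⟨⟨s, hs'⟩, ⟨t, ht'⟩, fun h => hnot ?_⟩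
    have : s = t := congrArg Subtype.val h
    exact hs.mono le_rfl (this ▸ hbt)
  obtain ⟨e⟩ := Order.embedding_from_countable_to_dense ℚ T
  exact hsc.false (e.trans (OrderEmbedding.subtype _))

/-- A compact scattered linear order all of whose points have an immediate successor or an
immediate predecessor belongs to the class `R`. -/
theorem IsScatteredOrder.classR (hsc : IsScatteredOrder L)
    (hL : ∀ v : L, (∃ v', v ⋖ v') ∨ ∃ v', v' ⋖ v) : ClassR L := by
  cases isEmpty_or_nonempty L with
  | inl h => exact ClassR.of_finite L
  | inr h =>
    obtain ⟨b, -, hb⟩ := isCompact_univ.exists_isLeast (univ_nonempty (α := L))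
    obtain ⟨t, -, ht⟩ := isCompact_univ.exists_isGreatest (univ_nonempty (α := L))
    have hbt : b ≤ t := hb (mem_univ t)
    have huniv : Icc b t = univ := eq_univ_of_forall fun x => ⟨hb (mem_univ x), ht (mem_univ x)⟩
    exact (hsc.hereditarilyClassR hL b t b t le_rfl hbt le_rfl).of_homeomorph
      ((Homeomorph.setCongr huniv).trans (Homeomorph.Set.univ L)).symm

end

theorem mainTheorem9 (K : Type u) [LinearOrder K] [TopologicalSpace K] [OrderTopology K]
    [CompactSpace K] (hK : IsScatteredOrder K)
    [TopologicalSpace (K ×ₗ Fin 2)] [OrderTopology (K ×ₗ Fin 2)] :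
    IsScatteredOrder (K ×ₗ Fin 2) ∧ CompactSpace (K ×ₗ Fin 2) ∧ ClassR (K ×ₗ Fin 2) ∧
      (Monotone (fun x : K ×ₗ Fin 2 => (ofLex x).1) ∧
        Continuous (fun x : K ×ₗ Fin 2 => (ofLex x).1) ∧
        Function.Surjective (fun x : K ×ₗ Fin 2 => (ofLex x).1) ∧
        ∀ y : K, ((fun x : K ×ₗ Fin 2 => (ofLex x).1) ⁻¹' {y}).ncard = 2) ∧
      ClassRC K := by
  have hc : CompactSpace (K ×ₗ Fin 2) := compactSpace_lex_fin_two
  have hR : ClassR (K ×ₗ Fin 2) := hK.lex_fin_two.classR fun v => by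
    rcases lex_fin_two_cases v with h | h
    · exact Or.inl ⟨_, by rw [h]; exact lex_fin_two_covBy _⟩
    · exact Or.inr ⟨_, by rw [h]; exact lex_fin_two_covBy _⟩
  have hsurj : Function.Surjective (fun x : K ×ₗ Fin 2 => (ofLex x).1) := fun y =>
    ⟨toLex (y, 0), rfl⟩
  exact ⟨hK.lex_fin_two, hc, hR, ⟨monotone_fst_lex, continuous_fst_lex_fin_two, hsurj,
    ncard_fiber_fst_lex_fin_two⟩,
    .image _ K _ continuous_fst_lex_fin_two hsurj hR.classRC⟩
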